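/- **Setting.** An online minimization problem $P$ has a set $I$ of inputs $\sigma=(s,x_1,\dots,x_n)$, consisting of an initial state $s$ and $n=|\sigma|$ requests. An output is a sequence $(y_1,\dots,y_n)$ of answers, where the set of valid values of $y_i$ is non-empty and may depend on $s,x_1,\dots,x_i$ and $y_1,\dots,y_{i-1}$; each valid output has a cost in $[0,\infty)$, and $\mathrm{OPT}(\sigma)$ is the optimal (offline) cost of $\sigma$. A deterministic algorithm without advice computes a valid $y_i$ from $s,x_1,\dots,x_i$; a randomized algorithm without advice is a probability distribution over such algorithms. A deterministic algorithm with advice may in addition read bits from an infinite tape whose content is prepared by an oracle that knows the whole input; it has advice complexity $o(n)$ if for some $b(n)=o(n)$ it reads at most $b(n)$ bits on all inputs of length at most $n$. An algorithm $\mathrm{ALG}$ is $c$-competitive if there is a constant $\alpha$ with $\mathbb E[\mathrm{ALG}(\sigma)]\le c\cdot\mathrm{OPT}(\sigma)+\alpha$ for all $\sigma\in I$ (for deterministic algorithms without the expectation). **Repeatability.** The repeated problem $P^*$ has as inputs the sequences $\sigma^*=(\sigma_1;\dots;\sigma_r)$ of $r\ge1$ inputs (rounds) of $P$ with a common initial state.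 An algorithm for $P^*$ serves the rounds one after another, is told when a new round begins, remembers all earlier rounds, and outputs a valid $P$-output for each round; the cost is the sum of the costs of the rounds, and $\mathrm{OPT}^*$ is the optimal cost. $P$ is $\Sigma$-repeatable if every input of $P$ has only finitely many valid outputs and there are constants $k_1,k_2,k_3\ge 0$ and a map $g$ from the inputs of $P^*$ to the inputs of $P$ such that, for every input $\sigma^*$ of $P^*$ with $r$ rounds, $|g(\sigma^*)|\le|\sigma^*|+k_1r$ and $\mathrm{OPT}^*(\sigma^*)\ge \mathrm{OPT}(g(\sigma^*))-k_3r$, and such that for every deterministic algorithm $\mathrm{ALG}$ for $P$ without advice there is a deterministic algorithm $\mathrm{ALG}^*$ for $P^*$ without advice with $\mathrm{ALG}^*(\sigma^*)\le\mathrm{ALG}(g(\sigma^*))+k_2r$ for all $\sigma^*$. **Compactness.** $P$ is compact if for every constant $c>1$ such that no randomized algorithm without advice is $c'$-competitive for any $c'<c$, and for all $\varepsilon>0$ and $\alpha\ge0$, there is a probability distribution $p$ with finite support on $I$ such that $\mathbb E_{\sigma\sim p}[D(\sigma)]\ge(c-\varepsilon)\,\mathbb E_{\sigma\sim p}[\mathrm{OPT}(\sigma)]+\alpha$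 for every deterministic algorithm $D$ without advice. **Theorem.** Let $P$ be a compact and $\Sigma$-repeatable online minimization problem with at most $2^{n^{O(1)}}$ inputs of length $n$ (in particular, finitely many for each $n$), and let $c$ be a constant. The following are equivalent: 1. For every $\varepsilon>0$, there is a randomized $(c+\varepsilon)$-competitive algorithm for $P$ without advice. 2. For every $\varepsilon>0$, there is a deterministic $(c+\varepsilon)$-competitive algorithm for $P$ with advice complexity $o(n)$. -/

import Mathlib

open scoped NNReal
open MeasureTheory

noncomputable section

/-! ## Online minimization problems -/

/-- The answers `y₁, …, yₙ` produced on the request sequence `x₁, …, xₙ` by the rule `f`,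
where `yᵢ = f (x₁, …, xᵢ)`. -/
def onlineAnswers {X Y : Type*} (f : List X → Y) (xs : List X) : List Y :=
  List.ofFn fun i : Fin xs.length => f (xs.take (i + 1))

/-- `ys` is a sequence of valid answers for the request sequence `xs` with initial state `s`.
Here `valid s (x₁, …, xᵢ) (y₁, …, yᵢ₋₁)` is the set of values that `yᵢ` may take. -/
def IsValidAnswers {S X Y : Type*} (valid : S → List X → List Y → Set Y)
    (s : S) (xs : List X) (ys : List Y) : Prop :=
  ys.length = xs.length ∧
    ∀ (i : ℕ) (hi : i < ys.length), ys[i] ∈ valid s (xs.take (i + 1)) (ys.take i)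

/-- An online minimization problem with initial states in `S`, requests in `X`, answers in `Y`.
An input is a pair of an initial state and a finite sequence of requests. Whenever an answer has
to be computed, the set of valid answers is non-empty. Costs are non-negative real numbers. -/
structure OnlineProblem (S X Y : Type*) where
  /-- the set `I` of all inputs -/
  inputs : Set (S × List X)
  /-- the set of valid values of `yᵢ`, given `s`, `x₁, …, xᵢ` and `y₁, …, yᵢ₋₁` -/
  valid : S → List X → List Y → Set Y
  valid_nonempty : ∀ (s : S) (xs : List X), (s, xs) ∈ inputs →
    ∀ ys : List Y, ys.length < xs.length → IsValidAnswers valid s (xs.take ys.length) ys →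
      (valid s (xs.take (ys.length + 1)) ys).Nonempty
  /-- the cost of an output with respect to an input -/
  cost : S × List X → List Y → ℝ≥0

namespace OnlineProblem

variable {S X Y : Type*} (P : OnlineProblem S X Y)

/-- The set of valid outputs for an input. -/
def validOutputs (σ : S × List X) : Set (List Y) :=
  {ys | IsValidAnswers P.valid σ.1 σ.2 ys}

theorem validOutputs_nonempty {σ : S × List X} (hσ : σ ∈ P.inputs) :
    (P.validOutputs σ).Nonempty := by
  obtain ⟨s, xs⟩ := σ
  have key : ∀ n ≤ xs.length, ∃ ys : List Y, IsValidAnswers P.valid s (xs.take n) ys := by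
    intro n
    induction n with
    | zero => intro _; exact ⟨[], by simp [IsValidAnswers]⟩
    | succ n ih =>
      intro hn
      obtain ⟨ys, hys⟩ := ih (by omega)
      have hlen : ys.length = n := by
        have h := hys.1
        rw [List.length_take] at h
        omega
      obtain ⟨y, hy⟩ := P.valid_nonempty s xs hσ ys (by omega) (by rw [hlen]; exact hys)
      refine ⟨ys ++ [y], by simp [hlen]; omega, ?_⟩
      intro i hi
      rw [List.length_append, List.length_singleton, hlen] at hi
      rw [List.take_take, min_eq_left (by omega : i + 1 ≤ n + 1)]
      rcases Nat.lt_or_ge i n with h | h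
      · rw [List.getElem_append_left (by omega), List.take_append_of_le_length (by omega)]
        have h2 := hys.2 i (by omega)
        rwa [List.take_take, min_eq_left (by omega : i + 1 ≤ n)] at h2
      · have hin : i = ys.length := by omega
        subst hin
        simpa using hy
  obtain ⟨ys, hys⟩ := key xs.length le_rfl
  exact ⟨ys, by simpa [validOutputs] using hys⟩

/-- The cost `OPT(σ)` of an optimal offline solution. -/
def opt (σ : S × List X) : ℝ :=
  sInf ((fun ys => (P.cost σ ys : ℝ)) '' P.validOutputs σ)

/-! ## Algorithms -/

/-- A deterministic online algorithm without advice: the answer `yᵢ` is a function of the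
initial state and of `x₁, …, xᵢ`, and the answers are valid on every input. -/
structure Algorithm where
  answer : S → List X → Y
  valid : ∀ σ ∈ P.inputs, onlineAnswers (answer σ.1) σ.2 ∈ P.validOutputs σ

/-- The cost `D(σ)` incurred by a deterministic algorithm without advice. -/
def Algorithm.costOn {P : OnlineProblem S X Y} (D : P.Algorithm) (σ : S × List X) : ℝ :=
  P.cost σ (onlineAnswers (D.answer σ.1) σ.2)

/-- A randomized online algorithm without advice: a probability distribution over
deterministic online algorithms without advice. The σ-algebra is part of the distribution. -/
structure RandomizedAlgorithm where
  events : MeasurableSpace P.Algorithm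
  law : @Measure P.Algorithm events
  isProbabilityMeasure : @IsProbabilityMeasure P.Algorithm events law

/-- A randomized algorithm is `c`-competitive if, for a constant `α`, its cost on every input `σ`
is a random variable with finite expectation at most `c · OPT(σ) + α`. -/
def RandomizedAlgorithm.IsCompetitive {P : OnlineProblem S X Y} (R : P.RandomizedAlgorithm)
    (c : ℝ) : Prop :=
  ∃ α : ℝ, ∀ σ ∈ P.inputs,
    Integrable (fun D : P.Algorithm => D.costOn σ) R.law ∧
      integral R.law (fun D : P.Algorithm => D.costOn σ) ≤ c * P.opt σ + α

/-- A deterministic online algorithm with advice. An oracle, who sees the whole input, prepares an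
infinite tape of bits; the answer `yᵢ` is a function of the tape, the initial state and
`x₁, …, xᵢ`; with the tape prepared for the input, the answers have to be valid. -/
structure AdviceAlgorithm where
  oracle : S × List X → (ℕ → Bool)
  answer : (ℕ → Bool) → S → List X → Y
  valid : ∀ σ ∈ P.inputs,
    onlineAnswers (answer (oracle σ) σ.1) σ.2 ∈ P.validOutputs σ

/-- The cost incurred on an input by a deterministic algorithm with advice. -/
def AdviceAlgorithm.costOn {P : OnlineProblem S X Y} (A : P.AdviceAlgorithm)
    (σ : S × List X) : ℝ :=
  P.cost σ (onlineAnswers (A.answer (A.oracle σ) σ.1) σ.2)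

/-- A deterministic algorithm with advice is `c`-competitive if its cost is at most
`c · OPT(σ) + α` for every input `σ`, where `α` is a constant. -/
def AdviceAlgorithm.IsCompetitive {P : OnlineProblem S X Y} (A : P.AdviceAlgorithm)
    (c : ℝ) : Prop :=
  ∃ α : ℝ, ∀ σ ∈ P.inputs, A.costOn σ ≤ c * P.opt σ + α

/-- On the input `σ` the algorithm reads at most the first `b` bits of its tape: no change of the
tape behind these bits has an effect on its answers. -/
def AdviceAlgorithm.ReadsAtMost {P : OnlineProblem S X Y} (A : P.AdviceAlgorithm)
    (σ : S × List X) (b : ℕ) : Prop :=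
  ∀ φ : ℕ → Bool, (∀ j < b, φ j = A.oracle σ j) →
    onlineAnswers (A.answer φ σ.1) σ.2 = onlineAnswers (A.answer (A.oracle σ) σ.1) σ.2

/-- The advice complexity is `o(n)`: on inputs of length at most `n`, at most `b n` bits are
read, where `b n / n → 0`. -/
def AdviceAlgorithm.HasSublinearAdvice {P : OnlineProblem S X Y} (A : P.AdviceAlgorithm) : Prop :=
  ∃ b : ℕ → ℕ,
    (∀ (n : ℕ), ∀ σ ∈ P.inputs, σ.2.length ≤ n → A.ReadsAtMost σ (b n)) ∧
    Asymptotics.IsLittleO Filter.atTop (fun n : ℕ => (b n : ℝ)) (fun n : ℕ => (n : ℝ))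

/-! ## The repeated problem -/

/-- The inputs `(σ₁; …; σᵣ)` of the repeated problem: `r ≥ 1` inputs of `P` (rounds) with the same
initial state `s`, written as `s` together with the list of the `r` request sequences. -/
def repInputs : Set (S × List (List X)) :=
  {σ | σ.2 ≠ [] ∧ ∀ xs ∈ σ.2, (σ.1, xs) ∈ P.inputs}

/-- The number of requests in an input of the repeated problem. -/
def repLength (σ : S × List (List X)) : ℕ := (σ.2.map List.length).sum

/-- The valid outputs `(γ₁, …, γᵣ)` of the repeated problem: each `γᵢ` is a valid output for the
`i`th round. -/
def repValidOutputs (σ : S × List (List X)) : Set (List (List Y)) :=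
  {γ | List.Forall₂ (fun xs ys => ys ∈ P.validOutputs (σ.1, xs)) σ.2 γ}

/-- The cost of an output of the repeated problem: the sum of the costs of all rounds. -/
def repCost (σ : S × List (List X)) (γ : List (List Y)) : ℝ :=
  (List.zipWith (fun xs ys => (P.cost (σ.1, xs) ys : ℝ)) σ.2 γ).sum

/-- The optimal offline cost of the repeated problem. -/
def repOpt (σ : S × List (List X)) : ℝ :=
  sInf (P.repCost σ '' P.repValidOutputs σ)

/-- The output of the rule `f` on an input of the repeated problem. The answer to a request is a
function of the initial state, the list of all earlier rounds, and the requests of the current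
round up to and including the present one; so the rule is told where a new round begins, and it
remembers all earlier rounds. -/
def repAnswers (f : S → List (List X) → List X → Y) (σ : S × List (List X)) : List (List Y) :=
  List.ofFn fun i : Fin σ.2.length => onlineAnswers (f σ.1 (σ.2.take i)) σ.2[i]

/-- A deterministic online algorithm without advice for the repeated problem. -/
structure RepAlgorithm where
  answer : S → List (List X) → List X → Y
  valid : ∀ σ ∈ P.repInputs, repAnswers answer σ ∈ P.repValidOutputs σ

/-- The cost incurred by an algorithm for the repeated problem. -/
def RepAlgorithm.costOn {P : OnlineProblem S X Y} (A : P.RepAlgorithm)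
    (σ : S × List (List X)) : ℝ :=
  P.repCost σ (repAnswers A.answer σ)

/-- `P` is Σ-repeatable with parameters `(k₁, k₂, k₃)`. -/
def IsSumRepeatableWith (k₁ k₂ k₃ : ℝ) : Prop :=
  (∀ σ ∈ P.inputs, (P.validOutputs σ).Finite) ∧
  ∃ g : S × List (List X) → S × List X,
    (∀ σ ∈ P.repInputs, g σ ∈ P.inputs) ∧
    (∀ σ ∈ P.repInputs, ((g σ).2.length : ℝ) ≤ repLength σ + k₁ * σ.2.length) ∧
    (∀ A : P.Algorithm, ∃ A' : P.RepAlgorithm, ∀ σ ∈ P.repInputs,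
      A'.costOn σ ≤ A.costOn (g σ) + k₂ * σ.2.length) ∧
    (∀ σ ∈ P.repInputs, P.repOpt σ ≥ P.opt (g σ) - k₃ * σ.2.length)

/-- `P` is Σ-repeatable. -/
def IsSumRepeatable : Prop :=
  ∃ k₁ k₂ k₃ : ℝ, 0 ≤ k₁ ∧ 0 ≤ k₂ ∧ 0 ≤ k₃ ∧ P.IsSumRepeatableWith k₁ k₂ k₃

/-! ## Compactness -/

/-- The expected competitive ratio of every randomized algorithm without advice is at least `c`:
no such algorithm is `c'`-competitive for any `c' < c`. -/
def RandomizedRatioAtLeast (c : ℝ) : Prop :=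
  ∀ R : P.RandomizedAlgorithm, ∀ c' < c, ¬ R.IsCompetitive c'

/-- `p` is a probability distribution with finite support over the inputs of `P`. -/
def IsInputDistribution (p : (S × List X) →₀ ℝ≥0) : Prop :=
  (∀ σ ∈ p.support, σ ∈ P.inputs) ∧ (p.sum fun _ w => w) = 1

/-- The expected value of `f` under a distribution with finite support. -/
def expectation (p : (S × List X) →₀ ℝ≥0) (f : S × List X → ℝ) : ℝ :=
  p.sum fun σ w => (w : ℝ) * f σ

/-- `P` is compact: whenever `c > 1` is a lower bound on the expected competitive ratio of all
randomized algorithms without advice, then for all `ε > 0` and `α ≥ 0` there is an input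
distribution with finite support on which the expected cost of every deterministic algorithm
without advice is at least `(c - ε) · E[OPT] + α`. -/
def IsCompactProblem : Prop :=
  ∀ c : ℝ, 1 < c → P.RandomizedRatioAtLeast c →
    ∀ ε : ℝ, 0 < ε → ∀ α : ℝ, 0 ≤ α →
      ∃ p : (S × List X) →₀ ℝ≥0, P.IsInputDistribution p ∧
        ∀ D : P.Algorithm,
          expectation p D.costOn ≥ (c - ε) * expectation p P.opt + α

/-! ## The number of inputs -/

/-- There are at most `2 ^ (n ^ O(1))` inputs of length `n`: finitely many for every `n`, and at
most `2 ^ (n ^ k)` for some constant `k` and all sufficiently large `n`. -/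
def HasFewInputs : Prop :=
  (∀ n : ℕ, {σ ∈ P.inputs | σ.2.length = n}.Finite) ∧
  ∃ k : ℕ, ∀ᶠ n : ℕ in Filter.atTop,
    {σ ∈ P.inputs | σ.2.length = n}.ncard ≤ 2 ^ (n ^ k)

end OnlineProblem

end

/-! ## Answer sequences -/

/-! From randomness to advice: on a finite set of inputs, Markov's inequality yields one
deterministic algorithm that exceeds the expected cost by a factor above `d > 1` on at most a
fraction `1/d` of them. Iterating on the bad inputs covers all inputs of length `n` by polynomially
many algorithms, since there are only `2 ^ (n ^ O(1))` such inputs. The advice is `n` and an index,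
`O(log n)` bits (`RandomizedAlgorithm.exists_algorithms`, `selectAlgorithm`).

From advice to randomness: if no randomized algorithm is `d`-competitive, compactness gives a
distribution that is hard for every deterministic algorithm, with any desired additive surplus. An
algorithm reading `b` bits amounts to `2 ^ b` algorithms without advice, which repeatability carries
over to the repeated problem. A sequence of `r` rounds hard for all of them at once is built
greedily with an exponential potential (`exists_hard_rounds`). The number `2 ^ b` costs only `b =
o(r)` in the exponent, so the surplus per round survives and contradicts competitiveness
(`AdviceAlgorithm.not_isCompetitive`). -/

theorem onlineAnswers_nil {X Y : Type*} (f : List X → Y) : onlineAnswers f [] = [] := by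
  simp [onlineAnswers]

theorem onlineAnswers_concat {X Y : Type*} (f : List X → Y) (xs : List X) (x : X) :
    onlineAnswers f (xs ++ [x]) = onlineAnswers f xs ++ [f (xs ++ [x])] := by
  apply List.ext_getElem
  · simp [onlineAnswers]
  · intro i h₁ h₂
    simp only [onlineAnswers, List.length_ofFn, List.length_append, List.length_singleton] at h₁
    rcases Nat.lt_or_ge i xs.length with h | h
    · rw [List.getElem_append_left (by simpa [onlineAnswers] using h)]
      simp [onlineAnswers, -List.ofFn_succ, List.take_append_of_le_length (by omega : i + 1 ≤ xs.length)]
    · obtain rfl : i = xs.length := by omega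
      rw [List.getElem_append_right (by simp [onlineAnswers])]
      simp [onlineAnswers, -List.ofFn_succ, List.take_of_length_le]

theorem isValidAnswers_nil {S X Y : Type*} (valid : S → List X → List Y → Set Y) (s : S) :
    IsValidAnswers valid s [] [] := by
  simp [IsValidAnswers]

theorem isValidAnswers_concat {S X Y : Type*} {valid : S → List X → List Y → Set Y} {s : S}
    {xs : List X} {x : X} {ys : List Y} {y : Y} :
    IsValidAnswers valid s (xs ++ [x]) (ys ++ [y]) ↔
      IsValidAnswers valid s xs ys ∧ y ∈ valid s (xs ++ [x]) ys := by
  constructor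
  · rintro ⟨hlen, h⟩
    have hlen' : ys.length = xs.length := by simpa using hlen
    refine ⟨⟨hlen', fun i hi => ?_⟩, ?_⟩
    · have := h i (by simp; omega)
      rwa [List.getElem_append_left hi, List.take_append_of_le_length (by omega),
        List.take_append_of_le_length (by omega)] at this
    · have := h ys.length (by simp)
      rw [List.take_of_length_le (by simp [hlen'])] at this
      simpa using this
  · rintro ⟨⟨hlen, h⟩, hy⟩
    refine ⟨by simp [hlen], fun i hi => ?_⟩
    rcases Nat.lt_or_ge i ys.length with hi' | hi'
    · rw [List.getElem_append_left hi', List.take_append_of_le_length (by omega),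
        List.take_append_of_le_length (by omega)]
      exact h i hi'
    · obtain rfl : i = ys.length := by
        rw [List.length_append, List.length_singleton] at hi
        omega
      rw [List.take_of_length_le (by simp [hlen])]
      simpa using hy

namespace OnlineProblem

variable {S X Y : Type*} {P : OnlineProblem S X Y}

theorem opt_nonneg (σ : S × List X) : 0 ≤ P.opt σ := by
  apply Real.sInf_nonneg
  rintro _ ⟨ys, -, rfl⟩
  exact NNReal.coe_nonneg _

theorem bddBelow_costs (σ : S × List X) :
    BddBelow ((fun ys => (P.cost σ ys : ℝ)) '' P.validOutputs σ) :=
  ⟨0, by rintro _ ⟨ys, -, rfl⟩; exact NNReal.coe_nonneg _⟩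

theorem opt_le_cost {σ : S × List X} {ys : List Y} (h : ys ∈ P.validOutputs σ) :
    P.opt σ ≤ P.cost σ ys :=
  csInf_le (bddBelow_costs σ) ⟨ys, h, rfl⟩

theorem Algorithm.costOn_nonneg (D : P.Algorithm) (σ : S × List X) : 0 ≤ D.costOn σ :=
  NNReal.coe_nonneg _

theorem AdviceAlgorithm.opt_le_costOn (A : P.AdviceAlgorithm) {σ : S × List X}
    (hσ : σ ∈ P.inputs) : P.opt σ ≤ A.costOn σ :=
  opt_le_cost (A.valid σ hσ)

/-! ## Making a rule valid on all inputs -/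

open Classical in
/-- The answer of a rule if it is valid, and an arbitrary valid answer otherwise. -/
noncomputable def validAnswer (P : OnlineProblem S X Y) (f : S → List X → Y) (s : S)
    (xs : List X) (ys : List Y) : Y :=
  if f s xs ∈ P.valid s xs ys then f s xs
  else if h : (P.valid s xs ys).Nonempty then h.some else f s xs

theorem validAnswer_mem (f : S → List X → Y) {s : S} {xs : List X} {ys : List Y}
    (h : (P.valid s xs ys).Nonempty) : P.validAnswer f s xs ys ∈ P.valid s xs ys := by
  unfold validAnswer
  split_ifs with h₁
  · exact h₁
  · exact h.some_mem

/-- The output of a rule whose invalid answers are replaced by valid ones. -/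
noncomputable def repairedOutput (P : OnlineProblem S X Y) (f : S → List X → Y) (s : S)
    (xs : List X) : List Y :=
  List.reverseRecOn (motive := fun _ => List Y) xs []
    fun zs x ys => ys ++ [P.validAnswer f s (zs ++ [x]) ys]

theorem repairedOutput_nil (f : S → List X → Y) (s : S) : P.repairedOutput f s [] = [] := by
  simp [repairedOutput]

theorem repairedOutput_concat (f : S → List X → Y) (s : S) (xs : List X) (x : X) :
    P.repairedOutput f s (xs ++ [x]) = P.repairedOutput f s xs ++
      [P.validAnswer f s (xs ++ [x]) (P.repairedOutput f s xs)] := by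
  simp [repairedOutput]

theorem onlineAnswers_repaired (f : S → List X → Y) (s : S) (xs : List X) :
    onlineAnswers (fun zs => P.validAnswer f s zs (P.repairedOutput f s zs.dropLast)) xs =
      P.repairedOutput f s xs := by
  induction xs using List.reverseRecOn with
  | nil => simp [onlineAnswers_nil, repairedOutput_nil]
  | append_singleton xs x ih =>
    rw [onlineAnswers_concat, ih, repairedOutput_concat, List.dropLast_concat]

/-- The continuation `zs` carries the induction: inputs need not be closed under prefixes, and valid
answers are known to exist only along prefixes of inputs. -/
theorem isValidAnswers_repairedOutput (f : S → List X → Y) (s : S) (xs : List X) :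
    ∀ zs : List X, (s, xs ++ zs) ∈ P.inputs →
      IsValidAnswers P.valid s xs (P.repairedOutput f s xs) := by
  induction xs using List.reverseRecOn with
  | nil => intro _ _; rw [repairedOutput_nil]; exact isValidAnswers_nil _ _
  | append_singleton xs x ih =>
    intro zs hzs
    have hxs := ih (x :: zs) (by simpa using hzs)
    rw [repairedOutput_concat, isValidAnswers_concat]
    refine ⟨hxs, validAnswer_mem f ?_⟩
    have hlen := hxs.1
    have := P.valid_nonempty s _ hzs (P.repairedOutput f s xs) (by simp [hlen])
      (by simpa [hlen] using hxs)
    rwa [hlen, List.take_append_of_le_length (by simp), List.take_of_length_le (by simp)] at this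

theorem repairedOutput_eq (f : S → List X → Y) (s : S) (xs : List X)
    (h : IsValidAnswers P.valid s xs (onlineAnswers (f s) xs)) :
    P.repairedOutput f s xs = onlineAnswers (f s) xs := by
  induction xs using List.reverseRecOn with
  | nil => rw [repairedOutput_nil, onlineAnswers_nil]
  | append_singleton xs x ih =>
    rw [onlineAnswers_concat, isValidAnswers_concat] at h
    rw [repairedOutput_concat, onlineAnswers_concat, ih h.1, validAnswer, if_pos h.2]

/-- The algorithm that follows a rule and replaces its invalid answers by valid ones. -/
noncomputable def repair (P : OnlineProblem S X Y) (f : S → List X → Y) : P.Algorithm where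
  answer s xs := P.validAnswer f s xs (P.repairedOutput f s xs.dropLast)
  valid := by
    rintro ⟨s, xs⟩ hσ
    rw [onlineAnswers_repaired]
    exact isValidAnswers_repairedOutput f s xs [] (by simpa using hσ)

theorem repair_costOn (f : S → List X → Y) {σ : S × List X}
    (h : onlineAnswers (f σ.1) σ.2 ∈ P.validOutputs σ) :
    (P.repair f).costOn σ = P.cost σ (onlineAnswers (f σ.1) σ.2) := by
  simp only [Algorithm.costOn, repair]
  rw [onlineAnswers_repaired, repairedOutput_eq f σ.1 σ.2 h]

/-- With a fixed tape, an advice algorithm may answer invalidly on inputs the tape was not prepared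
for. Repairing gives an honest algorithm and changes nothing where the tape starts with the right
advice. -/
theorem AdviceAlgorithm.repair_costOn (A : P.AdviceAlgorithm) {σ : S × List X} {b : ℕ}
    (hσ : σ ∈ P.inputs) (hb : A.ReadsAtMost σ b) {φ : ℕ → Bool}
    (hφ : ∀ j < b, φ j = A.oracle σ j) : (P.repair (A.answer φ)).costOn σ = A.costOn σ := by
  have h := hb φ hφ
  rw [OnlineProblem.repair_costOn _ (h ▸ A.valid σ hσ), h, AdviceAlgorithm.costOn]

/-- The algorithm that behaves like `D s` for the initial state `s`. -/
def glue (D : S → P.Algorithm) : P.Algorithm where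
  answer s := (D s).answer s
  valid σ hσ := (D σ.1).valid σ hσ

theorem glue_costOn (D : S → P.Algorithm) (σ : S × List X) :
    (glue D).costOn σ = (D σ.1).costOn σ := rfl

/-! ## Rounds of the repeated problem -/

theorem repAnswers_concat (f : S → List (List X) → List X → Y) (s : S) (h : List (List X))
    (xs : List X) :
    repAnswers f (s, h ++ [xs]) = repAnswers f (s, h) ++ [onlineAnswers (f s h) xs] := by
  apply List.ext_getElem
  · simp [repAnswers]
  · intro i h₁ h₂
    simp only [repAnswers, List.length_ofFn, List.length_append, List.length_singleton] at h₁
    rcases Nat.lt_or_ge i h.length with hi | hi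
    · rw [List.getElem_append_left (by simpa [repAnswers] using hi)]
      simp [repAnswers, -List.ofFn_succ, List.take_append_of_le_length hi.le, List.getElem_append_left hi]
    · obtain rfl : i = h.length := by omega
      rw [List.getElem_append_right (by simp [repAnswers])]
      simp [repAnswers, -List.ofFn_succ]

theorem repAnswers_length (f : S → List (List X) → List X → Y) (σ : S × List (List X)) :
    (repAnswers f σ).length = σ.2.length := by
  simp [repAnswers]

theorem RepAlgorithm.costOn_nil (A : P.RepAlgorithm) (s : S) : A.costOn (s, []) = 0 := by
  simp [RepAlgorithm.costOn, repCost]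

theorem RepAlgorithm.costOn_concat (A : P.RepAlgorithm) (s : S) (h : List (List X))
    (xs : List X) :
    A.costOn (s, h ++ [xs]) =
      A.costOn (s, h) + P.cost (s, xs) (onlineAnswers (A.answer s h) xs) := by
  simp only [RepAlgorithm.costOn, repCost, repAnswers_concat]
  rw [List.zipWith_append (by rw [repAnswers_length])]
  simp

theorem RepAlgorithm.valid_round (A : P.RepAlgorithm) {s : S} {h : List (List X)}
    (hh : ∀ xs ∈ h, (s, xs) ∈ P.inputs) {xs : List X} (hxs : (s, xs) ∈ P.inputs) :
    onlineAnswers (A.answer s h) xs ∈ P.validOutputs (s, xs) := by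
  have hv := A.valid (s, h ++ [xs]) ⟨by simp, by
    intro zs hzs
    rcases List.mem_append.1 hzs with hzs | hzs
    · exact hh zs hzs
    · rw [List.mem_singleton.1 hzs]; exact hxs⟩
  rw [repAnswers_concat] at hv
  have := List.Forall₂.get hv (i := h.length) (by simp) (by simp [repAnswers_length])
  simpa [List.getElem_append_right, repAnswers_length] using this

open Classical in
/-- The way in which an algorithm for the repeated problem serves the round that follows the
rounds `h`. -/
noncomputable def RepAlgorithm.round (A : P.RepAlgorithm) (D : P.Algorithm) (s : S)
    (h : List (List X)) (hh : ∀ xs ∈ h, (s, xs) ∈ P.inputs) : P.Algorithm where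
  -- The rounds `h` are inputs only for the state `s`, so `D` has to take over for other states.
  answer := Function.update D.answer s (A.answer s h)
  valid := by
    rintro ⟨t, xs⟩ hσ
    by_cases ht : t = s
    · subst ht
      simpa using A.valid_round hh hσ
    · simpa [Function.update_of_ne ht] using D.valid _ hσ

theorem RepAlgorithm.round_costOn (A : P.RepAlgorithm) (D : P.Algorithm) {s : S}
    {h : List (List X)} (hh : ∀ xs ∈ h, (s, xs) ∈ P.inputs) (xs : List X) :
    (A.round D s h hh).costOn (s, xs) = P.cost (s, xs) (onlineAnswers (A.answer s h) xs) := by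
  simp [Algorithm.costOn, RepAlgorithm.round]

theorem exists_cost_eq_opt {σ : S × List X} (hσ : σ ∈ P.inputs) (hfin : (P.validOutputs σ).Finite) :
    ∃ ys ∈ P.validOutputs σ, (P.cost σ ys : ℝ) = P.opt σ :=
  (((validOutputs_nonempty P hσ).image _).csInf_mem (hfin.image _))

/-- Finiteness makes each round's optimum attained; the optimal outputs together serve the repeated
input. -/
theorem repOpt_le_sum_opt (hfin : ∀ σ ∈ P.inputs, (P.validOutputs σ).Finite) {s : S}
    {h : List (List X)} (hh : ∀ xs ∈ h, (s, xs) ∈ P.inputs) :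
    P.repOpt (s, h) ≤ (h.map fun xs => P.opt (s, xs)).sum := by
  have key : ∃ γ ∈ P.repValidOutputs (s, h),
      P.repCost (s, h) γ = (h.map fun xs => P.opt (s, xs)).sum := by
    induction h with
    | nil => exact ⟨[], by simp [repValidOutputs], by simp [repCost]⟩
    | cons xs h ih =>
      obtain ⟨γ, hγ, hcost⟩ := ih fun zs hzs => hh zs (List.mem_cons_of_mem _ hzs)
      have hxs := hh xs List.mem_cons_self
      obtain ⟨ys, hys, hopt⟩ := exists_cost_eq_opt hxs (hfin _ hxs)
      refine ⟨ys :: γ, List.Forall₂.cons hys hγ, ?_⟩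
      simp only [repCost] at hcost
      simp [repCost, hcost, hopt]
  obtain ⟨γ, hγ, hcost⟩ := key
  rw [← hcost]
  refine csInf_le ⟨0, ?_⟩ ⟨γ, hγ, rfl⟩
  rintro _ ⟨γ', -, rfl⟩
  apply List.sum_nonneg
  intro a ha
  rw [List.mem_iff_getElem] at ha
  obtain ⟨i, hi, rfl⟩ := ha
  simp

/-! ## Building a hard input of the repeated problem round by round -/

/-- If none of the variables `Z i` has a negative mean, then some outcome increases the exponential
potential only slightly. -/
theorem exists_potential_le {ι β : Type*} [Fintype ι] (F : Finset β) (w : β → ℝ)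
    (hw : ∀ x ∈ F, 0 ≤ w x) (hpos : 0 < ∑ x ∈ F, w x) (Z : ι → β → ℝ) {M l : ℝ}
    (hl : 0 ≤ l) (hlM : l * M ≤ 1) (hM : ∀ i, ∀ x ∈ F, |Z i x| ≤ M)
    (hZ : ∀ i, 0 ≤ ∑ x ∈ F, w x * Z i x) (a : ι → ℝ) :
    ∃ x ∈ F, ∑ i, Real.exp (-l * (a i + Z i x)) ≤
      (1 + (l * M) ^ 2) * ∑ i, Real.exp (-l * a i) := by
  by_contra! hcon
  have hne : ∃ x ∈ F, 0 < w x := by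
    by_contra! h
    exact absurd (Finset.sum_nonpos h) (not_le.2 hpos)
  obtain ⟨x₀, hx₀, hwx₀⟩ := hne
  have hlt : ∑ x ∈ F, w x * ((1 + (l * M) ^ 2) * ∑ i, Real.exp (-l * a i)) <
      ∑ x ∈ F, w x * ∑ i, Real.exp (-l * (a i + Z i x)) :=
    Finset.sum_lt_sum (fun x hx => mul_le_mul_of_nonneg_left (hcon x hx).le (hw x hx))
      ⟨x₀, hx₀, mul_lt_mul_of_pos_left (hcon x₀ hx₀) hwx₀⟩
  refine absurd hlt (not_lt.2 ?_)
  -- Uses `exp z ≤ 1 + z + z²` for `|z| ≤ 1`. On average the linear term does not increase the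
  -- potential, by `hZ`, so only the square remains.
  have hexp : ∀ i, ∀ x ∈ F, Real.exp (-l * Z i x) ≤ 1 + (l * M) ^ 2 - l * Z i x := by
    intro i x hx
    have habs : |-l * Z i x| ≤ l * M := by
      rw [abs_mul, abs_neg, abs_of_nonneg hl]
      exact mul_le_mul_of_nonneg_left (hM i x hx) hl
    have h₁ := (abs_le.1 (Real.abs_exp_sub_one_sub_id_le (habs.trans hlM))).2
    have h₂ : (-l * Z i x) ^ 2 ≤ (l * M) ^ 2 := sq_le_sq.2 (habs.trans (le_abs_self _))
    linarith
  calc ∑ x ∈ F, w x * ∑ i, Real.exp (-l * (a i + Z i x))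
      = ∑ i, Real.exp (-l * a i) * ∑ x ∈ F, w x * Real.exp (-l * Z i x) := by
        simp only [Finset.mul_sum]
        rw [Finset.sum_comm]
        refine Finset.sum_congr rfl fun i _ => Finset.sum_congr rfl fun x _ => ?_
        rw [mul_add, Real.exp_add]
        ring
    _ ≤ ∑ i, Real.exp (-l * a i) * ((1 + (l * M) ^ 2) * ∑ x ∈ F, w x) := by
        refine Finset.sum_le_sum fun i _ => mul_le_mul_of_nonneg_left ?_ (Real.exp_pos _).le
        calc ∑ x ∈ F, w x * Real.exp (-l * Z i x)
            ≤ ∑ x ∈ F, w x * (1 + (l * M) ^ 2 - l * Z i x) :=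
              Finset.sum_le_sum fun x hx => mul_le_mul_of_nonneg_left (hexp i x hx) (hw x hx)
          _ = (1 + (l * M) ^ 2) * ∑ x ∈ F, w x - l * ∑ x ∈ F, w x * Z i x := by
              simp only [Finset.mul_sum, ← Finset.sum_sub_distrib]
              exact Finset.sum_congr rfl fun x _ => by ring
          _ ≤ (1 + (l * M) ^ 2) * ∑ x ∈ F, w x := by
              linarith [mul_nonneg hl (hZ i)]
    _ = ∑ x ∈ F, w x * ((1 + (l * M) ^ 2) * ∑ i, Real.exp (-l * a i)) := by
        rw [← Finset.sum_mul, ← Finset.sum_mul]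
        ring

/-- If every algorithm has a large mean cost on a distribution of rounds, then there are rounds on
which finitely many algorithms for the repeated problem have a large cost simultaneously. -/
theorem exists_hard_rounds {ι : Type*} [Fintype ι] (A : ι → P.RepAlgorithm) (D₀ : P.Algorithm)
    (s : S) (F : Finset (List X)) (hF : ∀ xs ∈ F, (s, xs) ∈ P.inputs) (w : List X → ℝ)
    (hw : ∀ x ∈ F, 0 ≤ w x) (hpos : 0 < ∑ x ∈ F, w x) {c α M l : ℝ} (hl : 0 ≤ l)
    (hlM : l * M ≤ 1)
    (hM : ∀ D : P.Algorithm, ∀ xs ∈ F, |D.costOn (s, xs) - c * P.opt (s, xs) - α| ≤ M)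
    (hD : ∀ D : P.Algorithm,
      0 ≤ ∑ xs ∈ F, w xs * (D.costOn (s, xs) - c * P.opt (s, xs) - α)) (r : ℕ) :
    ∃ h : List (List X), h.length = r ∧ (∀ xs ∈ h, xs ∈ F) ∧
      ∑ i, Real.exp (-l * ((A i).costOn (s, h) -
        c * (h.map fun xs => P.opt (s, xs)).sum - α * r)) ≤
      Fintype.card ι * (1 + (l * M) ^ 2) ^ r := by
  induction r with
  | zero => exact ⟨[], rfl, by simp, by simp [RepAlgorithm.costOn_nil]⟩
  | succ r ih =>
    obtain ⟨h, hlen, hmem, hpot⟩ := ih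
    have hh : ∀ xs ∈ h, (s, xs) ∈ P.inputs := fun xs hxs => hF xs (hmem xs hxs)
    -- Once `h` is fixed, each `A i` acts in the next round as an algorithm for `P`, so `hD` applies
    -- to all of them and one round suits them all.
    obtain ⟨xs, hxs, hle⟩ := exists_potential_le F w hw hpos
      (fun i xs => ((A i).round D₀ s h hh).costOn (s, xs) - c * P.opt (s, xs) - α)
      hl hlM (fun i => hM _) (fun i => hD _)
      (fun i => (A i).costOn (s, h) - c * (h.map fun xs => P.opt (s, xs)).sum - α * r)
    refine ⟨h ++ [xs], by simp [hlen], ?_, ?_⟩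
    · intro zs hzs
      rcases List.mem_append.1 hzs with hzs | hzs
      · exact hmem zs hzs
      · rwa [List.mem_singleton.1 hzs]
    · calc _ = _ := by
            refine Finset.sum_congr rfl fun i _ => ?_
            rw [RepAlgorithm.costOn_concat, ← RepAlgorithm.round_costOn (A i) D₀ hh xs]
            congr 2
            push_cast [List.map_append, List.sum_append, List.map_singleton, List.sum_singleton]
            ring
        _ ≤ _ := hle
        _ ≤ (1 + (l * M) ^ 2) * (Fintype.card ι * (1 + (l * M) ^ 2) ^ r) :=
            mul_le_mul_of_nonneg_left hpot (by positivity)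
        _ = _ := by ring

end OnlineProblem

namespace OnlineProblem

variable {S X Y : Type*} {P : OnlineProblem S X Y}

/-! ## Lower bounds for algorithms with advice -/

theorem AdviceAlgorithm.IsCompetitive.mono {A : P.AdviceAlgorithm} {c d : ℝ}
    (h : A.IsCompetitive c) (hcd : c ≤ d) : A.IsCompetitive d := by
  obtain ⟨α, hα⟩ := h
  exact ⟨α, fun σ hσ => (hα σ hσ).trans <| by
    gcongr
    exact opt_nonneg σ⟩

theorem RandomizedAlgorithm.IsCompetitive.mono {R : P.RandomizedAlgorithm} {c d : ℝ}
    (h : R.IsCompetitive c) (hcd : c ≤ d) : R.IsCompetitive d := by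
  obtain ⟨α, hα⟩ := h
  exact ⟨α, fun σ hσ => ⟨(hα σ hσ).1, (hα σ hσ).2.trans <| by
    gcongr
    exact opt_nonneg σ⟩⟩

/-- As the weights sum to one, `α` can move inside the sum; this form can be split by initial state
without renormalizing. -/
theorem sum_expectation {p : (S × List X) →₀ ℝ≥0} (hp : P.IsInputDistribution p)
    {D : P.Algorithm} {c α : ℝ}
    (h : expectation p D.costOn ≥ c * expectation p P.opt + α) :
    0 ≤ ∑ σ ∈ p.support, (p σ : ℝ) * (D.costOn σ - c * P.opt σ - α) := by
  have hsum : ∑ σ ∈ p.support, (p σ : ℝ) = 1 := by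
    have := hp.2
    rw [Finsupp.sum] at this
    exact_mod_cast this
  have heq : ∑ σ ∈ p.support, (p σ : ℝ) * (D.costOn σ - c * P.opt σ - α) =
      expectation p D.costOn - c * expectation p P.opt - α := by
    simp only [expectation, Finsupp.sum, Finset.mul_sum, mul_sub, Finset.sum_sub_distrib]
    rw [← Finset.sum_mul, hsum, one_mul]
    congr 2
    exact Finset.sum_congr rfl fun σ _ => by ring
  rw [heq]
  linarith

/-- A hard input distribution can be restricted to a single initial state. -/
theorem exists_hard_state {p : (S × List X) →₀ ℝ≥0} (hp : P.IsInputDistribution p) {c α : ℝ}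
    (h : ∀ D : P.Algorithm, expectation p D.costOn ≥ c * expectation p P.opt + α) :
    ∃ (s : S) (F : Finset (List X)) (w : List X → ℝ), (∀ xs ∈ F, (s, xs) ∈ P.inputs) ∧
      (∀ xs ∈ F, 0 ≤ w xs) ∧ 0 < ∑ xs ∈ F, w xs ∧
      ∀ D : P.Algorithm, 0 ≤ ∑ xs ∈ F, w xs * (D.costOn (s, xs) - c * P.opt (s, xs) - α) := by
  classical
  have hfib : ∃ s ∈ p.support.image Prod.fst, ∀ D : P.Algorithm,
      0 ≤ ∑ σ ∈ p.support with σ.1 = s, (p σ : ℝ) * (D.costOn σ - c * P.opt σ - α) := by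
    -- Otherwise each occurring state has an algorithm with negative sum, and gluing these gives one
    -- algorithm that contradicts the hardness of `p`.
    by_contra! hcon
    have hne : (p.support.image Prod.fst).Nonempty := by
      rw [Finset.image_nonempty, Finset.nonempty_iff_ne_empty]
      intro h0
      have := hp.2
      simp [Finsupp.sum, h0] at this
    obtain ⟨s₀, hs₀⟩ := hne
    obtain ⟨D₀, -⟩ := hcon s₀ hs₀
    have hcon' : ∀ s, ∃ D : P.Algorithm, s ∈ p.support.image Prod.fst →
        ∑ σ ∈ p.support with σ.1 = s, (p σ : ℝ) * (D.costOn σ - c * P.opt σ - α) < 0 := by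
      intro s
      by_cases hs : s ∈ p.support.image Prod.fst
      · obtain ⟨D, hD⟩ := hcon s hs
        exact ⟨D, fun _ => hD⟩
      · exact ⟨D₀, fun h' => absurd h' hs⟩
    choose D hD using hcon'
    have hglue := sum_expectation hp (h (glue D))
    rw [← Finset.sum_fiberwise_of_maps_to
      (fun σ hσ => Finset.mem_image_of_mem Prod.fst hσ)] at hglue
    refine absurd hglue (not_le.2 (Finset.sum_neg (fun s hs => ?_) ⟨s₀, hs₀⟩))
    refine lt_of_eq_of_lt (Finset.sum_congr rfl fun σ hσ => ?_) (hD s hs)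
    rw [glue_costOn, (Finset.mem_filter.1 hσ).2]
  obtain ⟨s, hs, hD⟩ := hfib
  have hsum : ∀ f : S × List X → ℝ,
      ∑ xs ∈ (p.support.filter fun σ => σ.1 = s).image Prod.snd, f (s, xs) =
        ∑ σ ∈ p.support with σ.1 = s, f σ := by
    intro f
    rw [Finset.sum_image]
    · refine Finset.sum_congr rfl fun σ hσ => ?_
      rw [← (Finset.mem_filter.1 hσ).2]
    · intro σ hσ τ hτ hστ
      exact Prod.ext (((Finset.mem_filter.1 hσ).2).trans (Finset.mem_filter.1 hτ).2.symm) hστ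
  refine ⟨s, (p.support.filter fun σ => σ.1 = s).image Prod.snd, fun xs => p (s, xs),
    ?_, fun xs _ => NNReal.coe_nonneg _, ?_, fun D => ?_⟩
  · intro xs hxs
    obtain ⟨⟨t, zs⟩, hσ, rfl⟩ := Finset.mem_image.1 hxs
    obtain ⟨hσ', rfl⟩ := Finset.mem_filter.1 hσ
    exact hp.1 _ hσ'
  · rw [hsum fun σ => (p σ : ℝ)]
    obtain ⟨σ, hσ, rfl⟩ := Finset.mem_image.1 hs
    refine Finset.sum_pos (fun τ hτ => ?_) ⟨σ, Finset.mem_filter.2 ⟨hσ, rfl⟩⟩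
    exact_mod_cast pos_iff_ne_zero.2 (Finsupp.mem_support_iff.1 (Finset.mem_filter.1 hτ).1)
  · rw [hsum fun σ => (p σ : ℝ) * (D.costOn σ - c * P.opt σ - α)]
    exact hD D

/-- The bound is uniform over possibly infinitely many algorithms, because costs depend only on the
finitely many outputs. It bounds the increments in the potential argument. -/
theorem exists_cost_bound (hfin : ∀ σ ∈ P.inputs, (P.validOutputs σ).Finite) {s : S}
    (F : Finset (List X)) (hF : ∀ xs ∈ F, (s, xs) ∈ P.inputs) :
    ∃ B : ℝ, 0 ≤ B ∧ ∀ D : P.Algorithm, ∀ xs ∈ F, D.costOn (s, xs) ≤ B := by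
  have hfinite : (⋃ xs ∈ F, (fun ys => (P.cost (s, xs) ys : ℝ)) '' P.validOutputs (s, xs)).Finite :=
    Set.Finite.biUnion F.finite_toSet fun xs hxs => (hfin _ (hF xs hxs)).image _
  obtain ⟨B, hB⟩ := hfinite.bddAbove
  refine ⟨max B 0, le_max_right _ _, fun D xs hxs => le_max_of_le_left (hB ?_)⟩
  exact Set.mem_biUnion hxs ⟨_, D.valid _ (hF xs hxs), rfl⟩

/-- A tape that starts with the bits `φ`. -/
def tapeOf {b : ℕ} (φ : Fin b → Bool) (j : ℕ) : Bool := if h : j < b then φ ⟨j, h⟩ else false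

/-- If at most `b n` bits of advice are read and `b` is sublinear, then for some large `r` the
number of bits read on inputs of length `K r` is small compared to `r`. -/
theorem exists_rounds_of_isLittleO {b : ℕ → ℕ}
    (hb : Asymptotics.IsLittleO Filter.atTop (fun n : ℕ => (b n : ℝ)) (fun n : ℕ => (n : ℝ)))
    {K : ℕ} (hK : 0 < K) {l : ℝ} (hl : 0 < l) (α : ℝ) :
    ∃ r : ℕ, 0 < r ∧ α < r ∧ (b (K * r) : ℝ) ≤ l * r := by
  have hKr : Filter.Tendsto (fun r : ℕ => K * r) Filter.atTop Filter.atTop :=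
    Filter.tendsto_id.const_mul_atTop' hK
  have hK' : (0 : ℝ) < K := by exact_mod_cast hK
  have h₁ := hKr.eventually (hb.def (div_pos hl hK'))
  have h₂ := tendsto_natCast_atTop_atTop.eventually_gt_atTop α (α := ℕ) (β := ℝ)
  obtain ⟨r, ⟨h₁, h₂⟩, h₃⟩ := ((h₁.and h₂).and (Filter.eventually_gt_atTop 0)).exists
  refine ⟨r, h₃, h₂, ?_⟩
  simp only [Real.norm_natCast] at h₁
  push_cast at h₁
  rwa [← mul_assoc, div_mul_cancel₀ _ hK'.ne'] at h₁

/-- Taking logarithms gives `-l T ≤ b + r (l M)²`, where both summands are at most `l r / 2`: one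
pays for the number of tapes, the other for the growth of the potential. -/
theorem neg_le_of_exp_le {b r : ℕ} {l M T : ℝ} (hl : 0 < l) (hlM : l * M ^ 2 = 1 / 2)
    (hb : (b : ℝ) ≤ l / 2 * r)
    (h : Real.exp (-l * T) ≤ ((2 ^ b : ℕ) : ℝ) * (1 + (l * M) ^ 2) ^ r) : -(r : ℝ) ≤ T := by
  have h₁ : ((2 ^ b : ℕ) : ℝ) ≤ Real.exp b := by
    have h2 : (2 : ℝ) ≤ Real.exp 1 := by linarith [Real.add_one_le_exp (1 : ℝ)]
    calc ((2 ^ b : ℕ) : ℝ) = 2 ^ b := by push_cast; rfl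
      _ ≤ Real.exp 1 ^ b := pow_le_pow_left₀ (by norm_num) h2 b
      _ = Real.exp b := by rw [← Real.exp_nat_mul, mul_one]
  have h₂ : (1 + (l * M) ^ 2) ^ r ≤ Real.exp (r * (l * M) ^ 2) := by
    rw [Real.exp_nat_mul]
    exact pow_le_pow_left₀ (by positivity) (by linarith [Real.add_one_le_exp ((l * M) ^ 2)]) r
  have h₃ : Real.exp (-l * T) ≤ Real.exp (b + r * (l * M) ^ 2) := by
    rw [Real.exp_add]
    exact h.trans (mul_le_mul h₁ h₂ (by positivity) (Real.exp_pos _).le)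
  rw [Real.exp_le_exp] at h₃
  have h₄ : (l * M) ^ 2 = l * (1 / 2) := by rw [← hlM]; ring
  rw [h₄] at h₃
  have h₅ : l * (-(r : ℝ)) ≤ l * T := by linarith
  exact le_of_mul_le_mul_left h₅ hl

/-- An algorithm with sublinear advice cannot beat a lower bound on the ratio of all randomized
algorithms. -/
theorem AdviceAlgorithm.not_isCompetitive (hcompact : P.IsCompactProblem)
    (hrep : P.IsSumRepeatable) {c₁ c₂ : ℝ} (h1 : 1 < c₂) (hlt : c₁ < c₂)
    (hratio : P.RandomizedRatioAtLeast c₂) (A : P.AdviceAlgorithm) (hA : A.HasSublinearAdvice) :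
    ¬ A.IsCompetitive c₁ := by
  intro hcomp
  -- The bound on `OPT` will be multiplied by the ratio, which must be non-negative; raising it to
  -- `1` keeps it below `c₂`.
  obtain ⟨α₀, hα₀⟩ := hcomp.mono (le_max_left c₁ 1)
  set c := max c₁ 1
  have hc1 : 1 ≤ c := le_max_right _ _
  have hc2 : c < c₂ := max_lt hlt h1
  obtain ⟨k₁, k₂, k₃, hk₁, hk₂, hk₃, hfin, g, hg, hglen, hgalg, hgopt⟩ := hrep
  obtain ⟨b, hreads, hb⟩ := hA
  -- Surplus per round: `k₂ + c * k₃` pays for the passage through `g`, `1` for the potential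
  -- argument, and the last `1` beats `α₀` after `r` rounds.
  have hα : 0 ≤ 2 + k₂ + c * k₃ := by positivity
  obtain ⟨p, hp, hpD⟩ := hcompact c₂ h1 hratio (c₂ - c) (by linarith) _ hα
  rw [sub_sub_cancel] at hpD
  obtain ⟨s, F, w, hF, hw, hpos, hD⟩ := exists_hard_state hp hpD
  obtain ⟨B, hB0, hB⟩ := exists_cost_bound hfin F hF
  set α := 2 + k₂ + c * k₃ with hαdef
  have hα2 : 2 ≤ α := by nlinarith
  obtain ⟨M, hMdef⟩ : ∃ M, M = B + c * B + α := ⟨_, rfl⟩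
  have hcB : 0 ≤ c * B := by positivity
  have hM2 : 2 ≤ M := by linarith
  have hM : ∀ D : P.Algorithm, ∀ xs ∈ F, |D.costOn (s, xs) - c * P.opt (s, xs) - α| ≤ M := by
    intro D xs hxs
    have h₁ := hB D xs hxs
    have h₂ := D.costOn_nonneg (s, xs)
    have h₃ : c * P.opt (s, xs) ≤ c * B :=
      mul_le_mul_of_nonneg_left ((opt_le_cost (D.valid _ (hF xs hxs))).trans h₁) (by linarith)
    have h₄ : 0 ≤ c * P.opt (s, xs) := mul_nonneg (by linarith) (opt_nonneg _)
    rw [abs_le]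
    constructor <;> linarith
  obtain ⟨l, hldef⟩ : ∃ l : ℝ, l = 1 / (2 * M ^ 2) := ⟨_, rfl⟩
  have hl : 0 < l := by rw [hldef]; positivity
  have hlM2 : l * M ^ 2 = 1 / 2 := by rw [hldef]; field_simp
  have hlM : l * M ≤ 1 := by nlinarith [mul_pos hl (by linarith : 0 < M)]
  -- `g` maps `r` rounds from `F` to an input of length at most `K * r`; the `+ 1` keeps `K`
  -- positive.
  set K := F.sup List.length + ⌈k₁⌉₊ + 1 with hK
  obtain ⟨r, hr0, hrα, hbr⟩ := exists_rounds_of_isLittleO hb (K := K) (by omega) (half_pos hl) α₀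
  choose A' hA' using hgalg
  -- The rounds must be hard for all tape prefixes at once, as the oracle chooses its bits knowing
  -- `g (s, h)`.
  obtain ⟨h, hlen, hmem, hpot⟩ := exists_hard_rounds
    (fun φ : Fin (b (K * r)) → Bool => A' (P.repair (A.answer (tapeOf φ))))
    (P.repair (A.answer (tapeOf fun _ : Fin 0 => false))) s F hF w hw hpos hl.le hlM hM hD r
  have hh : ∀ xs ∈ h, (s, xs) ∈ P.inputs := fun xs hxs => hF xs (hmem xs hxs)
  have hin : (s, h) ∈ P.repInputs :=
    ⟨by rintro h0; simp only at h0; simp [h0] at hlen; omega, hh⟩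
  have hglen' : (g (s, h)).2.length ≤ K * r := by
    have h₁ := hglen _ hin
    have h₂ : repLength (s, h) ≤ r * F.sup List.length := by
      have := List.sum_le_card_nsmul (h.map List.length) (F.sup List.length) (by
        intro m hm
        obtain ⟨xs, hxs, rfl⟩ := List.mem_map.1 hm
        exact Finset.le_sup (hmem xs hxs))
      simpa [repLength, hlen] using this
    have h₂' : (repLength (s, h) : ℝ) ≤ r * (F.sup List.length : ℕ) := by exact_mod_cast h₂
    have h₃ : k₁ * r ≤ ⌈k₁⌉₊ * r := by
      gcongr
      exact Nat.le_ceil k₁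
    simp only [hlen] at h₁
    have h₄ : ((g (s, h)).2.length : ℝ) ≤ ((K * r : ℕ) : ℝ) := by
      rw [hK]
      push_cast
      nlinarith
    exact_mod_cast h₄
  have hread := hreads (K * r) _ (hg _ hin) hglen'
  have hcost := A.repair_costOn (hg _ hin) hread
    (φ := tapeOf fun j : Fin (b (K * r)) => A.oracle (g (s, h)) j)
    (fun j hj => by simp [tapeOf, hj])
  have hround := hA' (P.repair (A.answer
    (tapeOf fun j : Fin (b (K * r)) => A.oracle (g (s, h)) j))) _ hin
  rw [hcost] at hround
  have hsingle := (Finset.single_le_sum (fun φ _ => (Real.exp_pos _).le)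
    (Finset.mem_univ fun j : Fin (b (K * r)) => A.oracle (g (s, h)) j)).trans hpot
  have hT := neg_le_of_exp_le (b := b (K * r)) hl hlM2 hbr (by simpa using hsingle)
  have hopt := hgopt _ hin
  have hsum := repOpt_le_sum_opt hfin hh
  have hcompg := hα₀ _ (hg _ hin)
  simp only [hlen] at hround hopt
  have hcopt : c * P.opt (g (s, h)) ≤
      c * ((h.map fun xs => P.opt (s, xs)).sum + k₃ * r) :=
    mul_le_mul_of_nonneg_left (by linarith) (by linarith)
  -- `hT` leaves a surplus of `(1 + k₂ + c * k₃) * r`, while competitiveness allows only `(k₂ + c *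
  -- k₃) * r + α₀`; this contradicts `α₀ < r`.
  rw [hαdef] at hT
  nlinarith

/-- If an algorithm with sublinear advice is `c`-competitive, then some randomized algorithm without
advice is `d`-competitive for every `d > c`. -/
theorem AdviceAlgorithm.exists_randomized (hcompact : P.IsCompactProblem)
    (hrep : P.IsSumRepeatable) (A : P.AdviceAlgorithm) (hA : A.HasSublinearAdvice) {c d : ℝ}
    (hcd : c < d) (hc : A.IsCompetitive c) : ∃ R : P.RandomizedAlgorithm, R.IsCompetitive d := by
  by_contra! hcon
  rcases lt_or_ge 1 d with hd | hd
  · exact A.not_isCompetitive hcompact hrep hd hcd (fun R c' hc' h => hcon R (h.mono hc'.le)) hA hc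
  · obtain ⟨α, hα⟩ := hc
    have hopt : ∀ σ ∈ P.inputs, P.opt σ ≤ α / (1 - c) := by
      intro σ hσ
      rw [le_div_iff₀ (by linarith)]
      linarith [hα σ hσ, A.opt_le_costOn hσ]
    -- Compactness says nothing for ratios at most `1`. But here `OPT` is bounded, so any ratio can
    -- be traded for an additive constant, and `2` is a lower bound as well.
    refine A.not_isCompetitive hcompact hrep (c₁ := 1) one_lt_two one_lt_two ?_ hA
      (AdviceAlgorithm.IsCompetitive.mono ⟨α, hα⟩ (by linarith))
    rintro R c' hc' h
    obtain ⟨β, hβ⟩ := h.mono (le_max_left c' d)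
    refine hcon R ⟨(max c' d - d) * (α / (1 - c)) + β, fun σ hσ => ⟨(hβ σ hσ).1, ?_⟩⟩
    have := mul_le_mul_of_nonneg_left (hopt σ hσ) (sub_nonneg.2 (le_max_right c' d))
    linarith [(hβ σ hσ).2]

end OnlineProblem

/-! ## A prefix code for natural numbers -/

/-- The tape `1…10d₀d₁…`, where `d₀, d₁, …` are the binary digits of `v` and the number of leading
ones is the number of these digits. -/
def selfDelimitingTape (v j : ℕ) : Bool :=
  if j < v.size then true else if j = v.size then false else v.testBit (j - v.size - 1)

/-- The leading ones reveal the number of digits, and thus where the code ends. -/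
theorem selfDelimitingTape_inj {v w : ℕ} {φ : ℕ → Bool}
    (hv : ∀ j < 2 * v.size + 1, φ j = selfDelimitingTape v j)
    (hw : ∀ j < 2 * w.size + 1, φ j = selfDelimitingTape w j) : v = w := by
  have hsize : v.size = w.size := by
    rcases lt_trichotomy v.size w.size with h | h | h
    · have h₁ := hv v.size (by omega)
      rw [hw v.size (by omega)] at h₁
      simp [selfDelimitingTape, h] at h₁
    · exact h
    · have h₁ := hw w.size (by omega)
      rw [hv w.size (by omega)] at h₁
      simp [selfDelimitingTape, h] at h₁
  refine Nat.eq_of_testBit_eq fun i => ?_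
  rcases Nat.lt_or_ge i v.size with hi | hi
  · have h₁ := hv (v.size + 1 + i) (by omega)
    rw [hw (v.size + 1 + i) (by omega)] at h₁
    have h₂ : v.size + 1 + i - v.size - 1 = i := by omega
    rw [selfDelimitingTape, selfDelimitingTape, ← hsize, if_neg (by omega), if_neg (by omega),
      if_neg (by omega), if_neg (by omega), h₂] at h₁
    exact h₁.symm
  · rw [Nat.testBit_lt_two_pow (Nat.size_le.1 hi), Nat.testBit_lt_two_pow (Nat.size_le.1 (hsize ▸ hi))]

open Classical in
/-- The number whose code stands at the beginning of a tape. -/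
noncomputable def decodeTape (φ : ℕ → Bool) : ℕ :=
  if h : ∃ v : ℕ, ∀ j < 2 * v.size + 1, φ j = selfDelimitingTape v j then h.choose else 0

theorem decodeTape_eq {v : ℕ} {φ : ℕ → Bool}
    (hv : ∀ j < 2 * v.size + 1, φ j = selfDelimitingTape v j) : decodeTape φ = v := by
  have h : ∃ v : ℕ, ∀ j < 2 * v.size + 1, φ j = selfDelimitingTape v j := ⟨v, hv⟩
  rw [decodeTape, dif_pos h]
  exact selfDelimitingTape_inj h.choose_spec hv

theorem isLittleO_add_mul_natLog (a b : ℕ) :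
    Asymptotics.IsLittleO Filter.atTop (fun n : ℕ => ((a + b * Nat.log 2 (n + 1) : ℕ) : ℝ))
      (fun n : ℕ => (n : ℝ)) := by
  have htop : Filter.Tendsto (fun n : ℕ => (n : ℝ) + 1) Filter.atTop Filter.atTop :=
    Filter.tendsto_atTop_add_const_right _ _ tendsto_natCast_atTop_atTop
  have hO : Asymptotics.IsBigO Filter.atTop (fun n : ℕ => (n : ℝ) + 1) (fun n : ℕ => (n : ℝ)) := by
    refine Asymptotics.IsBigO.of_bound 2 ?_
    filter_upwards [Filter.eventually_ge_atTop 1] with n hn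
    have hn' : (1 : ℝ) ≤ n := by exact_mod_cast hn
    rw [Real.norm_of_nonneg (by positivity), Real.norm_natCast]
    linarith
  have hlog : Asymptotics.IsLittleO Filter.atTop (fun n : ℕ => Real.log ((n : ℝ) + 1))
      (fun n : ℕ => (n : ℝ)) :=
    (Real.isLittleO_log_id_atTop.comp_tendsto htop).trans_isBigO hO
  have hnat : Asymptotics.IsLittleO Filter.atTop (fun n : ℕ => (Nat.log 2 (n + 1) : ℝ))
      (fun n : ℕ => (n : ℝ)) := by
    refine Asymptotics.IsBigO.trans_isLittleO ?_ hlog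
    refine Asymptotics.IsBigO.of_bound (1 / Real.log 2) (Filter.Eventually.of_forall fun n => ?_)
    have h := Real.natLog_le_logb (n + 1) 2
    rw [Real.norm_natCast, Real.norm_of_nonneg (Real.log_nonneg (by simp)), one_div_mul_eq_div]
    simpa [Real.logb] using h
  have hconst : Asymptotics.IsLittleO Filter.atTop (fun _ : ℕ => (a : ℝ)) (fun n : ℕ => (n : ℝ)) :=
    Asymptotics.isLittleO_const_left.2 <| Or.inr <|
      tendsto_norm_atTop_atTop.comp tendsto_natCast_atTop_atTop
  simpa using hconst.add (hnat.const_mul_left (b : ℝ))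

namespace OnlineProblem

variable {S X Y : Type*} {P : OnlineProblem S X Y}

/-! ## Replacing randomization by advice -/

theorem AdviceAlgorithm.ReadsAtMost.mono {A : P.AdviceAlgorithm} {σ : S × List X} {a b : ℕ}
    (h : A.ReadsAtMost σ a) (hab : a ≤ b) : A.ReadsAtMost σ b :=
  fun φ hφ => h φ fun j hj => hφ j (hj.trans_le hab)

/-- The advice is the index of one of countably many algorithms. -/
noncomputable def selectAlgorithm (D : ℕ → P.Algorithm) (v : S × List X → ℕ) :
    P.AdviceAlgorithm where
  oracle σ := selfDelimitingTape (v σ)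
  answer φ := (D (decodeTape φ)).answer
  valid σ hσ := (D _).valid σ hσ

theorem selectAlgorithm_costOn (D : ℕ → P.Algorithm) (v : S × List X → ℕ) (σ : S × List X) :
    (selectAlgorithm D v).costOn σ = (D (v σ)).costOn σ := by
  simp only [AdviceAlgorithm.costOn, Algorithm.costOn, selectAlgorithm]
  rw [decodeTape_eq fun _ _ => rfl]

theorem selectAlgorithm_readsAtMost (D : ℕ → P.Algorithm) (v : S × List X → ℕ)
    (σ : S × List X) : (selectAlgorithm D v).ReadsAtMost σ (2 * (v σ).size + 1) := by
  intro φ hφ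
  simp only [selectAlgorithm] at hφ ⊢
  rw [decodeTape_eq hφ, decodeTape_eq fun _ _ => rfl]

open Classical in
/-- Some algorithm is almost as good as a randomized algorithm on a large part of a finite set of
inputs. -/
theorem RandomizedAlgorithm.exists_algorithm (R : P.RandomizedAlgorithm) (F : Finset (S × List X))
    (hF : ∀ σ ∈ F, Integrable (fun D : P.Algorithm => D.costOn σ) R.law) (d : ℝ) :
    ∃ D : P.Algorithm, d *
      (F.filter fun σ => ¬ D.costOn σ ≤ d * (integral R.law (fun D => D.costOn σ) + 1)).card ≤
        F.card := by
  let _ := R.events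
  have := R.isProbabilityMeasure
  set E : S × List X → ℝ := fun σ => integral R.law (fun D => D.costOn σ) with hE
  have hE0 : ∀ σ, 0 ≤ E σ := fun σ => integral_nonneg fun D => D.costOn_nonneg σ
  -- Each normalized cost has mean at most `1`, and `+ 1` avoids division by zero. An algorithm no
  -- worse than the mean of the sum has few inputs with a term above `d`.
  have hint : Integrable (fun D : P.Algorithm => ∑ σ ∈ F, D.costOn σ / (E σ + 1)) R.law :=
    integrable_finsetSum _ fun σ hσ => (hF σ hσ).div_const _
  obtain ⟨D, hD⟩ := exists_le_integral hint
  refine ⟨D, ?_⟩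
  have hle : ∑ σ ∈ F, D.costOn σ / (E σ + 1) ≤ F.card := by
    refine hD.trans ?_
    rw [integral_finsetSum _ fun σ hσ => (hF σ hσ).div_const _]
    calc _ ≤ ∑ σ ∈ F, (1 : ℝ) := by
          refine Finset.sum_le_sum fun σ _ => ?_
          rw [integral_div, div_le_one (by linarith [hE0 σ])]
          linarith
      _ = F.card := by simp
  refine le_trans ?_ hle
  calc d * (F.filter fun σ => ¬ D.costOn σ ≤ d * (E σ + 1)).card
      = ∑ σ ∈ F.filter fun σ => ¬ D.costOn σ ≤ d * (E σ + 1), d := by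
        simp [mul_comm]
    _ ≤ ∑ σ ∈ F.filter fun σ => ¬ D.costOn σ ≤ d * (E σ + 1), D.costOn σ / (E σ + 1) := by
        refine Finset.sum_le_sum fun σ hσ => ?_
        rw [le_div_iff₀ (by linarith [hE0 σ])]
        exact (not_le.1 (Finset.mem_filter.1 hσ).2).le
    _ ≤ ∑ σ ∈ F, D.costOn σ / (E σ + 1) := by
        refine Finset.sum_le_sum_of_subset_of_nonneg (Finset.filter_subset _ _) fun σ _ _ => ?_
        exact div_nonneg (D.costOn_nonneg σ) (by linarith [hE0 σ])

/-- Logarithmically many algorithms suffice to be almost as good as a randomized algorithm on each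
input of a finite set. -/
theorem RandomizedAlgorithm.exists_algorithms (R : P.RandomizedAlgorithm) {d : ℝ} (hd : 0 < d)
    (m : ℕ) : ∀ F : Finset (S × List X),
      (∀ σ ∈ F, Integrable (fun D : P.Algorithm => D.costOn σ) R.law) → (F.card : ℝ) < d ^ m →
      ∃ D : ℕ → P.Algorithm, ∀ σ ∈ F, ∃ i < m,
        (D i).costOn σ ≤ d * (integral R.law (fun D => D.costOn σ) + 1) := by
  classical
  induction m with
  | zero =>
    intro F hF hcard
    obtain ⟨D, -⟩ := R.exists_algorithm F hF d
    rw [pow_zero, Nat.cast_lt_one, Finset.card_eq_zero] at hcard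
    exact ⟨fun _ => D, by simp [hcard]⟩
  | succ m ih =>
    intro F hF hcard
    -- Fewer than `d ^ m` inputs are bad for `D`; the induction hypothesis handles them.
    obtain ⟨D, hD⟩ := R.exists_algorithm F hF d
    obtain ⟨D', hD'⟩ := ih
      (F.filter fun σ => ¬ D.costOn σ ≤ d * (integral R.law (fun D => D.costOn σ) + 1))
      (fun σ hσ => hF σ (Finset.mem_filter.1 hσ).1) (by
        have := hD.trans_lt hcard
        rw [pow_succ'] at this
        exact lt_of_mul_lt_mul_left this hd.le)
    refine ⟨fun i => i.casesOn D D', fun σ hσ => ?_⟩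
    by_cases h : D.costOn σ ≤ d * (integral R.law (fun D => D.costOn σ) + 1)
    · exact ⟨0, by omega, h⟩
    · obtain ⟨i, hi, hle⟩ := hD' σ (Finset.mem_filter.2 ⟨hσ, h⟩)
      exact ⟨i + 1, by omega, hle⟩

/-- Few inputs are covered by polynomially many steps of a geometric decay. -/
theorem HasFewInputs.exists_card_lt (hfew : P.HasFewInputs) {d : ℝ} (hd : 1 < d) :
    ∃ (m : ℕ → ℕ) (C k : ℕ), (∀ n, m n ≤ C * (n + 1) ^ k) ∧
      ∀ n, (({σ ∈ P.inputs | σ.2.length = n}.ncard : ℕ) : ℝ) < d ^ m n := by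
  obtain ⟨-, k, hk⟩ := hfew
  obtain ⟨N, hN⟩ := Filter.eventually_atTop.1 hk
  obtain ⟨q, hq⟩ := pow_unbounded_of_one_lt 2 hd
  have hm : ∀ n, ∃ m : ℕ, (({σ ∈ P.inputs | σ.2.length = n}.ncard : ℕ) : ℝ) < d ^ m ∧
      (N ≤ n → m = q * n ^ k + 1) := by
    intro n
    by_cases hn : N ≤ n
    · refine ⟨q * n ^ k + 1, ?_, fun _ => rfl⟩
      calc (({σ ∈ P.inputs | σ.2.length = n}.ncard : ℕ) : ℝ) ≤ 2 ^ (n ^ k) := by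
            exact_mod_cast hN n hn
        _ ≤ (d ^ q) ^ (n ^ k) := pow_le_pow_left₀ (by norm_num) hq.le _
        _ = d ^ (q * n ^ k) := (pow_mul _ _ _).symm
        _ < d ^ (q * n ^ k + 1) := pow_lt_pow_right₀ hd (by omega)
    · obtain ⟨m, hm⟩ := pow_unbounded_of_one_lt
        (({σ ∈ P.inputs | σ.2.length = n}.ncard : ℕ) : ℝ) hd
      exact ⟨m, hm, fun h => absurd h hn⟩
  choose m hcard hle using hm
  -- The supremum absorbs the lengths below `N`, where the bound on the number of inputs may fail.
  refine ⟨m, (Finset.range N).sup m + q + 1, k, fun n => ?_, hcard⟩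
  have h1 : 1 ≤ (n + 1) ^ k := Nat.one_le_pow _ _ (by omega)
  by_cases hn : N ≤ n
  · rw [hle n hn]
    have h2 : n ^ k ≤ (n + 1) ^ k := Nat.pow_le_pow_left (by omega) k
    nlinarith [Nat.mul_le_mul_left q h2]
  · have h2 : m n ≤ (Finset.range N).sup m :=
      Finset.le_sup (f := m) (Finset.mem_range.2 (by omega))
    nlinarith

/-- The pairing is at most quadratic in the larger entry, hence polynomial in `n`, so its digits are
logarithmically many. -/
theorem size_pair_le {n i C k j : ℕ} (hj : j ≤ n) (hi : i < C * (j + 1) ^ k) :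
    (Nat.pair j i).size ≤ 2 * (C + 1 + (k + 1) * (Nat.log 2 (n + 1) + 1)) := by
  rw [Nat.size_le]
  refine (Nat.pair_lt_max_add_one_sq j i).trans_le ?_
  rw [mul_comm 2, pow_mul]
  refine Nat.pow_le_pow_left ?_ 2
  have h1 : (n + 1) ^ (k + 1) ≤ 2 ^ ((k + 1) * (Nat.log 2 (n + 1) + 1)) := by
    rw [mul_comm, pow_mul]
    exact Nat.pow_le_pow_left (Nat.lt_pow_succ_log_self one_lt_two _).le _
  have h2 : C + 1 ≤ 2 ^ (C + 1) := Nat.lt_two_pow_self.le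
  have h3 : (j + 1) ^ k ≤ (n + 1) ^ (k + 1) :=
    (Nat.pow_le_pow_left (by omega) k).trans (Nat.pow_le_pow_right (by omega) (by omega))
  have h4 : n + 1 ≤ (n + 1) ^ (k + 1) := Nat.le_self_pow (by omega) _
  calc max j i + 1 ≤ (C + 1) * (n + 1) ^ (k + 1) := by
        have h5 := Nat.mul_le_mul_left C h3
        rcases max_cases j i with h | h <;> rw [h.1] <;> nlinarith
    _ ≤ 2 ^ (C + 1) * 2 ^ ((k + 1) * (Nat.log 2 (n + 1) + 1)) := Nat.mul_le_mul h2 h1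
    _ = _ := (pow_add _ _ _).symm

/-- Randomization can be replaced by sublinear advice if there are few inputs. -/
theorem RandomizedAlgorithm.exists_advice (hfew : P.HasFewInputs) (R : P.RandomizedAlgorithm)
    {c e : ℝ} (hce : c < e) (hc : R.IsCompetitive c) :
    ∃ A : P.AdviceAlgorithm, A.IsCompetitive e ∧ A.HasSublinearAdvice := by
  obtain ⟨α, hα⟩ := hc
  -- The gap between `c` and `e` pays for the factor `d` lost in Markov's inequality.
  obtain ⟨d, hd, hdc⟩ : ∃ d : ℝ, 1 < d ∧ d * c ≤ e := by
    rcases le_or_gt c 0 with h | h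
    · exact ⟨2, one_lt_two, by linarith⟩
    · exact ⟨e / c, (one_lt_div h).2 hce, (div_mul_cancel₀ e h.ne').le⟩
  obtain ⟨m, C, k, hm, hcard⟩ := hfew.exists_card_lt hd
  have hex : ∀ n, ∃ D : ℕ → P.Algorithm, ∀ σ ∈ P.inputs, σ.2.length = n → ∃ i < m n,
      (D i).costOn σ ≤ d * (integral R.law (fun D => D.costOn σ) + 1) := by
    intro n
    obtain ⟨D, hD⟩ := R.exists_algorithms (by linarith : 0 < d) (m n) (hfew.1 n).toFinset
      (fun σ hσ => (hα σ ((hfew.1 n).mem_toFinset.1 hσ).1).1)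
      (by rw [← Set.ncard_eq_toFinset_card _ (hfew.1 n)]; exact hcard n)
    exact ⟨D, fun σ hσ hn => hD σ ((hfew.1 n).mem_toFinset.2 ⟨hσ, hn⟩)⟩
  choose D hD using hex
  have hidx : ∀ σ : S × List X, ∃ i, σ ∈ P.inputs → i < m σ.2.length ∧
      (D σ.2.length i).costOn σ ≤ d * (integral R.law (fun D => D.costOn σ) + 1) := by
    intro σ
    by_cases hσ : σ ∈ P.inputs
    · obtain ⟨i, hi⟩ := hD _ σ hσ rfl
      exact ⟨i, fun _ => hi⟩
    · exact ⟨0, fun h => absurd h hσ⟩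
  choose i hi using hidx
  -- The list of algorithms depends on the length of the input, which is not known online, so the
  -- advice includes it.
  refine ⟨selectAlgorithm (fun v => D v.unpair.1 v.unpair.2)
    (fun σ => Nat.pair σ.2.length (i σ)), ⟨d * (α + 1), fun σ hσ => ?_⟩, ?_⟩
  · rw [selectAlgorithm_costOn, Nat.unpair_pair]
    have h1 := (hi σ hσ).2
    have h2 := mul_le_mul_of_nonneg_left (hα σ hσ).2 (by linarith : 0 ≤ d)
    have h3 := mul_le_mul_of_nonneg_right hdc (opt_nonneg (P := P) σ)
    simp only at h1 ⊢
    linarith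
  · refine ⟨fun n => 4 * (C + k + 2) + 1 + 4 * (k + 1) * Nat.log 2 (n + 1), ?_,
      isLittleO_add_mul_natLog _ _⟩
    intro n σ hσ hn
    refine (selectAlgorithm_readsAtMost _ _ σ).mono ?_
    have := size_pair_le hn ((hi σ hσ).1.trans_le (hm _))
    linarith

end OnlineProblem

theorem theorem2 {S X Y : Type*} (P : OnlineProblem S X Y)
    (hcompact : P.IsCompactProblem) (hrep : P.IsSumRepeatable) (hfew : P.HasFewInputs) (c : ℝ) :
    (∀ ε : ℝ, 0 < ε → ∃ R : P.RandomizedAlgorithm, R.IsCompetitive (c + ε)) ↔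
    (∀ ε : ℝ, 0 < ε → ∃ A : P.AdviceAlgorithm, A.IsCompetitive (c + ε) ∧ A.HasSublinearAdvice) := by
  constructor
  · intro h ε hε
    obtain ⟨R, hR⟩ := h (ε / 2) (half_pos hε)
    exact R.exists_advice hfew (by linarith) hR
  · intro h ε hε
    obtain ⟨A, hA, hadv⟩ := h (ε / 2) (half_pos hε)
    exact A.exists_randomized hcompact hrep hadv (by linarith) hA
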